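/- Let $\mathcal A$ be a commutative C$^*$-algebra (not necessarily unital), let $\ell^2(\mathcal A)$ be the standard Hilbert $\mathcal A$-module of all sequences $a=(a_j)_{j\in\mathbb Z}$ in $\mathcal A$ for which $\sum_{j} a_j^*a_j$ converges in norm, with $\|a\|_2=\big\|\sum_j a_j^*a_j\big\|^{1/2}$, and let $\sigma(\mathcal A)$ be the space of characters of $\mathcal A$ with the weak$^*$ topology. Let $\Phi:\mathcal A\to\mathcal A$ be an (automatically isometric) $*$-automorphism and let $b=(b_j)_{j\in\mathbb Z}\subseteq\mathcal A$ satisfy $\sup_j\|b_j\|<\infty$. For $n\in\mathbb N=\{1,2,\dots\}$ define the bounded operator $T_{\Phi,b,n}$ on $\ell^2(\mathcal A)$ by $$\big(T_{\Phi,b,n}(a)\big)_j:=\Big[\prod_{k=1}^n\Phi^{n-k}(b_{j-n+k})\Big]\,\Phi^n(a_{j-n})\qquad(j\in\mathbb Z),$$ and let $T_{\Phi,b,0}$ be the identity. Consider the statements: (1) The sequence $(T_{\Phi,b,n})_{n\ge 0}$ is hypercyclic, i.e. there is $x\in\ell^2(\mathcal A)$ such that $\{T_{\Phi,b,n}x: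 n\ge 0\}$ is dense in $\ell^2(\mathcal A)$. (2) For every non-empty compact $K\subseteq\sigma(\mathcal A)$ and every non-empty finite $I\subset\mathbb N$ there is a strictly increasing sequence $(r_k)_k$ in $\mathbb N$ such that for all $j\in I$ $$\lim_{k\to\infty}\Big(\sup_{h\in K}\prod_{i=1}^{r_k}\big|h(\Phi^{-i}(b_{i+j}))\big|\Big)=\lim_{k\to\infty}\Big(\sup_{h\in K}\prod_{i=1}^{r_k}\big|h(\Phi^{i-1}(b_{j-i+1}))\big|^{-1}\Big)=0,$$ where the suprema are taken in $[0,\infty]$ with $0^{-1}=\infty$. Then (1) implies (2). Conversely, if $\mathcal A$ is separable and unital, every $b_j$ is invertible in $\mathcal A$, and $\sup_{j}\|b_j^{-1}\|<\infty$, then (2) implies (1). -/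

import Mathlib

open scoped ENNReal

/-- A sequence `(T n)` of bounded operators on a normed space is *hypercyclic* if some vector `x`
has a dense orbit `{T n x : n = 0, 1, 2, …}`. -/
def IsHypercyclicSeq {X : Type*} [NormedAddCommGroup X] [NormedSpace ℂ X]
    (T : ℕ → X →L[ℂ] X) : Prop :=
  ∃ x : X, Dense (Set.range fun n => T n x)

section OrderLemmas

variable {A : Type*} [NonUnitalCommCStarAlgebra A]

theorem summable_of_nonneg_of_le_cstar [PartialOrder A] [StarOrderedRing A] {ι : Type*}
    {f g : ι → A} (hf : ∀ i, 0 ≤ f i) (hfg : ∀ i, f i ≤ g i) (hg : Summable g) :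
    Summable f := by
  rw [summable_iff_vanishing_norm] at hg ⊢
  intro ε hε
  obtain ⟨s, hs⟩ := hg ε hε
  refine ⟨s, fun t ht => lt_of_le_of_lt ?_ (hs t ht)⟩
  exact CStarAlgebra.norm_le_norm_of_nonneg_of_le (Finset.sum_nonneg fun i _ => hf i)
    (Finset.sum_le_sum fun i _ => hfg i)

theorem summable_star_mul_add {ι : Type*} {x y : ι → A}
    (hx : Summable fun j => star (x j) * x j) (hy : Summable fun j => star (y j) * y j) :
    Summable fun j => star (x j + y j) * (x j + y j) := by
  let _ := CStarAlgebra.spectralOrder A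
  have _ := CStarAlgebra.spectralOrderedRing A
  refine summable_of_nonneg_of_le_cstar (fun j => star_mul_self_nonneg _) (fun j => ?_)
    ((hx.add hy).add (hx.add hy))
  rw [← sub_nonneg]
  have h : star (x j) * x j + star (y j) * y j + (star (x j) * x j + star (y j) * y j)
      - star (x j + y j) * (x j + y j) = star (x j - y j) * (x j - y j) := by
    simp only [star_add, star_sub, add_mul, mul_add, sub_mul, mul_sub]
    abel
  rw [h]
  exact star_mul_self_nonneg _

theorem summable_star_mul_smul {ι : Type*} {x : ι → A} (c : ℂ)
    (hx : Summable fun j => star (x j) * x j) :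
    Summable fun j => star (c • x j) * (c • x j) := by
  have h : (fun j => star (c • x j) * (c • x j)) = fun j => (star c * c) • (star (x j) * x j) := by
    funext j
    rw [star_smul, smul_mul_smul_comm]
  rw [h]
  exact hx.const_smul _

theorem summable_star_mul_mul {ι : Type*} {x : ι → A} (a : A)
    (hx : Summable fun j => star (x j) * x j) :
    Summable fun j => star (a * x j) * (a * x j) := by
  have h : (fun j => star (a * x j) * (a * x j))
      = fun j => (star a * a) * (star (x j) * x j) := by
    funext j
    rw [star_mul]
    ac_rfl
  rw [h]
  exact hx.mul_left _

/-- By polarization, the inner product series of two members of `ℓ²(A)` converges. -/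
theorem summable_star_mul {ι : Type*} {x y : ι → A}
    (hx : Summable fun j => star (x j) * x j) (hy : Summable fun j => star (y j) * y j) :
    Summable fun j => star (x j) * y j := by
  have key : ∀ c : ℂ, Summable fun j =>
      c • (star (c • x j + y j) * (c • x j + y j)) := fun c =>
    (summable_star_mul_add (summable_star_mul_smul c hx) hy).const_smul _
  have h := ((((key 1).add (key (-1))).add (key Complex.I)).add (key (-Complex.I))).const_smul
    (4⁻¹ : ℂ)
  refine h.congr fun j => ?_
  simp only [star_add, star_smul, add_mul, mul_add, smul_mul_assoc, mul_smul_comm, smul_add,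
    smul_smul, Complex.star_def, map_neg, map_one, Complex.conj_I]
  match_scalars <;> (ring_nf; try simp; try norm_num)

/-- Multiplying `x` by finitely many elements bounded by `M` changes `x* x` by at most the factor
`M ^ (2 * #s)`, and it preserves convergence of `∑ x_j* x_j`. -/
theorem star_fold_mul_fold_le [PartialOrder A] [StarOrderedRing A] {M : ℝ} (s : Finset ℕ)
    (c : ℕ → A) (hc : ∀ k, ‖c k‖ ≤ M) (x : A) :
    star (s.fold (fun u v : A => u * v) x c) * s.fold (fun u v : A => u * v) x c ≤ (M ^ s.card) ^ 2 • (star x * x) := by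
  classical
  have hM : 0 ≤ M := (norm_nonneg _).trans (hc 0)
  induction s using Finset.induction_on with
  | empty => simp
  | insert a s ha ih =>
    rw [Finset.fold_insert ha, Finset.card_insert_of_notMem ha]
    set y := s.fold (fun u v : A => u * v) x c
    have h1 : star (c a * y) * (c a * y) = star y * (star (c a) * c a) * y := by
      rw [star_mul]
      ac_rfl
    rw [h1]
    refine (CStarAlgebra.star_left_conjugate_le_norm_smul
      (hb := IsSelfAdjoint.star_mul_self (c a))).trans ?_
    rw [CStarRing.norm_star_mul_self]
    calc (‖c a‖ * ‖c a‖) • (star y * y) ≤ (M * M) • (star y * y) := by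
          have h0 : 0 ≤ star y * y := star_mul_self_nonneg y
          have := hc a
          gcongr
      _ ≤ (M * M) • ((M ^ s.card) ^ 2 • (star x * x)) := by gcongr
      _ = (M ^ (s.card + 1)) ^ 2 • (star x * x) := by
          rw [smul_smul]
          congr 1
          ring

end OrderLemmas

/-- The complex vector space of all `a : ℤ → A` for which `∑ a_j* a_j` converges in norm. -/
def stdHilbertSubmodule (A : Type*) [NonUnitalCommCStarAlgebra A] : Submodule ℂ (ℤ → A) where
  carrier := {a | Summable fun j => star (a j) * a j}
  add_mem' hx hy := summable_star_mul_add hx hy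
  zero_mem' := by simp
  smul_mem' c _ hx := summable_star_mul_smul c hx

/-- The standard Hilbert module `ℓ²(A)`, indexed by `ℤ`: all `a : ℤ → A` for which `∑ a_j* a_j`
converges in norm, with `⟪a, b⟫ = ∑ a_j* b_j` and `‖a‖ = ‖∑ a_j* a_j‖ ^ (1/2)`. -/
def StdHilbertModule (A : Type*) [NonUnitalCommCStarAlgebra A] : Type _ :=
  stdHilbertSubmodule A

namespace StdHilbertModule

variable {A : Type*} [NonUnitalCommCStarAlgebra A]

noncomputable instance : AddCommGroup (StdHilbertModule A) :=
  inferInstanceAs (AddCommGroup (stdHilbertSubmodule A))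

noncomputable instance : Module ℂ (StdHilbertModule A) :=
  inferInstanceAs (Module ℂ (stdHilbertSubmodule A))

instance : CoeFun (StdHilbertModule A) fun _ => ℤ → A := ⟨Subtype.val⟩

theorem summable (a : StdHilbertModule A) : Summable fun j => star (a j) * a j := a.2

@[ext] theorem ext {a b : StdHilbertModule A} (h : ∀ j, a j = b j) : a = b :=
  Subtype.ext (funext h)

@[simp] theorem add_apply (a b : StdHilbertModule A) (j : ℤ) : (a + b) j = a j + b j := rfl
@[simp] theorem smul_apply (c : ℂ) (a : StdHilbertModule A) (j : ℤ) : (c • a) j = c • a j := rfl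
@[simp] theorem zero_apply (j : ℤ) : (0 : StdHilbertModule A) j = 0 := rfl

instance : SMul A (StdHilbertModule A) where
  smul c a := ⟨fun j => c * a j, summable_star_mul_mul c a.summable⟩

@[simp] theorem op_smul_apply (c : A) (a : StdHilbertModule A) (j : ℤ) :
    (c • a) j = c * a j := rfl

noncomputable instance : Inner A (StdHilbertModule A) where
  inner a b := ∑' j, star (a j) * b j

theorem inner_def (a b : StdHilbertModule A) : inner A a b = ∑' j, star (a j) * b j := rfl

noncomputable instance : Norm (StdHilbertModule A) where
  norm a := √‖∑' j, star (a j) * a j‖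

theorem norm_def (a : StdHilbertModule A) : ‖a‖ = √‖∑' j, star (a j) * a j‖ := rfl

/-- `ℓ²(A)` is a Hilbert `A`-module. -/
@[reducible]
noncomputable def cstarModule [PartialOrder A] [StarOrderedRing A] :
    CStarModule A (StdHilbertModule A) where
  inner_add_right {x y z} := by
    simp only [inner_def, add_apply, mul_add]
    exact (summable_star_mul x.summable y.summable).tsum_add
      (summable_star_mul x.summable z.summable)
  inner_self_nonneg := tsum_nonneg fun _ => star_mul_self_nonneg _
  inner_self {x} := by
    refine ⟨fun h => ?_, fun h => by simp [inner_def, h]⟩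
    ext j
    have h1 : star (x j) * x j ≤ 0 := by
      rw [← h]
      exact x.summable.le_tsum j fun _ _ => star_mul_self_nonneg _
    simpa using le_antisymm h1 (star_mul_self_nonneg _)
  inner_op_smul_right {c x y} := by
    simp only [inner_def, op_smul_apply]
    rw [← (summable_star_mul x.summable y.summable).tsum_mul_left]
    exact tsum_congr fun j => by ac_rfl
  inner_smul_right_complex {c x y} := by
    simp only [inner_def, smul_apply, mul_smul_comm]
    exact (summable_star_mul x.summable y.summable).tsum_const_smul c
  star_inner x y := by
    simp only [inner_def]
    rw [tsum_star]
    exact tsum_congr fun j => by rw [star_mul, star_star]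
  norm_eq_sqrt_norm_inner_self _ := rfl

theorem normedSpaceCore : NormedSpace.Core ℂ (StdHilbertModule A) :=
  let _ := CStarAlgebra.spectralOrder A
  have _ := CStarAlgebra.spectralOrderedRing A
  let _ := cstarModule (A := A)
  CStarModule.normedSpaceCore A

noncomputable instance : NormedAddCommGroup (StdHilbertModule A) :=
  NormedAddCommGroup.ofCore normedSpaceCore

noncomputable instance : NormedSpace ℂ (StdHilbertModule A) :=
  NormedSpace.ofCore normedSpaceCore

end StdHilbertModule

section Shift

variable {A : Type*} [NonUnitalCommCStarAlgebra A]

/-- `[∏_{k=1}^n Φ^{n-k}(b_{j-n+k})] Φ^n(a_{j-n})`. Since `A` need not have a unit, the bracket is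
not formed by itself: `Finset.fold` multiplies `Φ^n(a_{j-n})` by all the factors with
`1 ≤ k ≤ n`. For `n = 0` the value is `a_j`. -/
def shiftFun (Φ : A ≃⋆ₐ[ℂ] A) (b : ℤ → A) (n : ℕ) (a : ℤ → A) (j : ℤ) : A :=
  (Finset.Icc 1 n).fold (fun u v : A => u * v) (Φ^[n] (a (j - n))) fun k => Φ^[n - k] (b (j - n + k))

theorem norm_iterate_starAlgEquiv (Φ : A ≃⋆ₐ[ℂ] A) (n : ℕ) (a : A) : ‖Φ^[n] a‖ = ‖a‖ := by
  induction n with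
  | zero => rfl
  | succ n ih =>
    rw [Function.iterate_succ_apply', NonUnitalStarAlgHom.norm_map Φ (EquivLike.injective Φ), ih]

theorem iterate_starAlgEquiv_star_mul (Φ : A ≃⋆ₐ[ℂ] A) (n : ℕ) (a : A) :
    Φ^[n] (star a * a) = star (Φ^[n] a) * Φ^[n] a := by
  induction n with
  | zero => rfl
  | succ n ih => rw [Function.iterate_succ_apply', Function.iterate_succ_apply', ih, map_mul, map_star]

theorem iterate_starAlgEquiv_add (Φ : A ≃⋆ₐ[ℂ] A) (n : ℕ) (a a' : A) :
    Φ^[n] (a + a') = Φ^[n] a + Φ^[n] a' := by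
  induction n with
  | zero => rfl
  | succ n ih => simp only [Function.iterate_succ_apply', ih, map_add]

theorem iterate_starAlgEquiv_smul (Φ : A ≃⋆ₐ[ℂ] A) (n : ℕ) (c : ℂ) (a : A) :
    Φ^[n] (c • a) = c • Φ^[n] a := by
  induction n with
  | zero => rfl
  | succ n ih => simp only [Function.iterate_succ_apply', ih, map_smul]

theorem fold_mul_add (s : Finset ℕ) (c : ℕ → A) (x y : A) :
    s.fold (fun u v : A => u * v) (x + y) c
      = s.fold (fun u v : A => u * v) x c + s.fold (fun u v : A => u * v) y c := by
  classical
  induction s using Finset.induction_on with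
  | empty => rfl
  | insert a s ha ih => simp only [Finset.fold_insert ha, ih, mul_add]

theorem fold_mul_smul (s : Finset ℕ) (c : ℕ → A) (t : ℂ) (x : A) :
    s.fold (fun u v : A => u * v) (t • x) c = t • s.fold (fun u v : A => u * v) x c := by
  classical
  induction s using Finset.induction_on with
  | empty => rfl
  | insert a s ha ih => simp only [Finset.fold_insert ha, ih, mul_smul_comm]

theorem star_shiftFun_mul_shiftFun_le [PartialOrder A] [StarOrderedRing A]
    (Φ : A ≃⋆ₐ[ℂ] A) (b : ℤ → A) {M : ℝ} (hM : ∀ j, ‖b j‖ ≤ M) (n : ℕ) (a : ℤ → A) (j : ℤ) :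
    star (shiftFun Φ b n a j) * shiftFun Φ b n a j
      ≤ (M ^ n) ^ 2 • Φ^[n] (star (a (j - n)) * a (j - n)) := by
  have h := star_fold_mul_fold_le (M := M) (Finset.Icc 1 n)
    (fun k => Φ^[n - k] (b (j - n + k)))
    (fun k => by rw [norm_iterate_starAlgEquiv]; exact hM _) (Φ^[n] (a (j - n)))
  rw [Nat.card_Icc, Nat.add_sub_cancel] at h
  rw [iterate_starAlgEquiv_star_mul]
  exact h

/-- `Φ^n` as a continuous linear map. -/
noncomputable def iterateCLM (Φ : A ≃⋆ₐ[ℂ] A) (n : ℕ) : A →L[ℂ] A :=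
  LinearMap.mkContinuous
    { toFun := Φ^[n]
      map_add' := iterate_starAlgEquiv_add Φ n
      map_smul' := iterate_starAlgEquiv_smul Φ n } 1
    fun a => by simpa using (norm_iterate_starAlgEquiv Φ n a).le

theorem iterateCLM_apply (Φ : A ≃⋆ₐ[ℂ] A) (n : ℕ) (a : A) : iterateCLM Φ n a = Φ^[n] a := rfl

theorem summable_iterate_shift (Φ : A ≃⋆ₐ[ℂ] A) (n : ℕ) {a : ℤ → A}
    (ha : Summable fun j => star (a j) * a j) :
    Summable fun j : ℤ => Φ^[n] (star (a (j - n)) * a (j - n)) :=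
  ((Equiv.subRight (n : ℤ)).summable_iff.mpr ha).mapL (iterateCLM Φ n)

theorem tsum_iterate_shift (Φ : A ≃⋆ₐ[ℂ] A) (n : ℕ) {a : ℤ → A}
    (ha : Summable fun j => star (a j) * a j) :
    ∑' j : ℤ, Φ^[n] (star (a (j - n)) * a (j - n)) = Φ^[n] (∑' j, star (a j) * a j) := by
  have h := (iterateCLM Φ n).map_tsum ((Equiv.subRight (n : ℤ)).summable_iff.mpr ha)
  have h' := (Equiv.subRight (n : ℤ)).tsum_eq (fun j => star (a j) * a j)
  exact (congrArg (iterateCLM Φ n) h').symm.trans h |>.symm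

theorem summable_shiftFun (Φ : A ≃⋆ₐ[ℂ] A) {b : ℤ → A}
    (hb : BddAbove (Set.range fun j => ‖b j‖)) (n : ℕ) {a : ℤ → A}
    (ha : Summable fun j => star (a j) * a j) :
    Summable fun j => star (shiftFun Φ b n a j) * shiftFun Φ b n a j := by
  let _ := CStarAlgebra.spectralOrder A
  have _ := CStarAlgebra.spectralOrderedRing A
  obtain ⟨M, hM⟩ := hb
  exact summable_of_nonneg_of_le_cstar (fun _ => star_mul_self_nonneg _)
    (star_shiftFun_mul_shiftFun_le Φ b (fun j => hM ⟨j, rfl⟩) n a)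
    ((summable_iterate_shift Φ n ha).const_smul _)

theorem norm_shiftFun_le (Φ : A ≃⋆ₐ[ℂ] A) {b : ℤ → A} {M : ℝ} (hM : ∀ j, ‖b j‖ ≤ M) (n : ℕ)
    {a : ℤ → A} (ha : Summable fun j => star (a j) * a j)
    (h : Summable fun j => star (shiftFun Φ b n a j) * shiftFun Φ b n a j) :
    √‖∑' j, star (shiftFun Φ b n a j) * shiftFun Φ b n a j‖
      ≤ M ^ n * √‖∑' j, star (a j) * a j‖ := by
  let _ := CStarAlgebra.spectralOrder A
  have _ := CStarAlgebra.spectralOrderedRing A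
  have hM0 : 0 ≤ M := (norm_nonneg _).trans (hM 0)
  have hs := summable_iterate_shift Φ n ha
  have h1 : ∑' j, star (shiftFun Φ b n a j) * shiftFun Φ b n a j
      ≤ (M ^ n) ^ 2 • Φ^[n] (∑' j, star (a j) * a j) := by
    rw [← tsum_iterate_shift Φ n ha, ← hs.tsum_const_smul]
    exact h.tsum_le_tsum (star_shiftFun_mul_shiftFun_le Φ b hM n a) (hs.const_smul _)
  have h2 := CStarAlgebra.norm_le_norm_of_nonneg_of_le
    (tsum_nonneg fun _ => star_mul_self_nonneg _) h1
  rw [norm_smul, norm_iterate_starAlgEquiv, Real.norm_of_nonneg (by positivity)] at h2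
  calc _ ≤ √((M ^ n) ^ 2 * ‖∑' j, star (a j) * a j‖) := Real.sqrt_le_sqrt h2
    _ = M ^ n * √‖∑' j, star (a j) * a j‖ := by
      rw [Real.sqrt_mul (by positivity), Real.sqrt_sq (by positivity)]

/-- The generalized bilateral weighted shift `T_{Φ,b,n}` on `ℓ²(A)`, a bounded operator:
`(T_{Φ,b,n} a)_j = [∏_{k=1}^n Φ^{n-k}(b_{j-n+k})] Φ^n(a_{j-n})`; `T_{Φ,b,0}` is the identity. -/
noncomputable def genBilateralShift (Φ : A ≃⋆ₐ[ℂ] A) (b : ℤ → A)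
    (hb : BddAbove (Set.range fun j => ‖b j‖)) (n : ℕ) :
    StdHilbertModule A →L[ℂ] StdHilbertModule A :=
  LinearMap.mkContinuousOfExistsBound
    { toFun := fun a => ⟨shiftFun Φ b n a, summable_shiftFun Φ hb n a.summable⟩
      map_add' := fun a a' => StdHilbertModule.ext fun j => by
        change shiftFun Φ b n (fun i => (a + a') i) j = shiftFun Φ b n a j + shiftFun Φ b n a' j
        simp only [shiftFun, StdHilbertModule.add_apply, iterate_starAlgEquiv_add, fold_mul_add]
      map_smul' := fun t a => StdHilbertModule.ext fun j => by
        change shiftFun Φ b n (fun i => (t • a) i) j = t • shiftFun Φ b n a j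
        simp only [shiftFun, StdHilbertModule.smul_apply, iterate_starAlgEquiv_smul,
          fold_mul_smul] }
    (by
      obtain ⟨M, hM⟩ := id hb
      exact ⟨M ^ n, fun a => norm_shiftFun_le Φ (fun j => hM ⟨j, rfl⟩) n a.summable
        (summable_shiftFun Φ hb n a.summable)⟩)

theorem genBilateralShift_apply (Φ : A ≃⋆ₐ[ℂ] A) (b : ℤ → A)
    (hb : BddAbove (Set.range fun j => ‖b j‖)) (n : ℕ) (a : StdHilbertModule A) (j : ℤ) :
    genBilateralShift Φ b hb n a j = (Finset.Icc 1 n).fold (fun u v : A => u * v)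
      (Φ^[n] (a (j - n))) (fun k => Φ^[n - k] (b (j - n + k))) := rfl

/-- For every non-empty compact set `K` of characters and every non-empty finite set `I` of positive
integers there is a strictly increasing sequence `r` of positive integers such that, for all
`j ∈ I`, both `sup_{h ∈ K} ∏_{i=1}^{r_k} |h(Φ^{-i}(b_{i+j}))|` and
`sup_{h ∈ K} ∏_{i=1}^{r_k} |h(Φ^{i-1}(b_{j-i+1}))|⁻¹` tend to `0`. The suprema are taken in
`[0, ∞]`, where `0⁻¹ = ∞`: a vanishing factor makes the second one infinite. -/
def WeightCondition (Φ : A ≃⋆ₐ[ℂ] A) (b : ℤ → A) : Prop :=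
  ∀ K : Set (WeakDual.characterSpace ℂ A), K.Nonempty → IsCompact K →
  ∀ I : Finset ℕ, I.Nonempty → (∀ j ∈ I, 0 < j) →
  ∃ r : ℕ → ℕ, StrictMono r ∧ (∀ k, 0 < r k) ∧ ∀ j ∈ I,
    Filter.Tendsto
      (fun k => ⨆ h ∈ K, ∏ i ∈ Finset.Icc 1 (r k), ‖h (Φ.symm^[i] (b (i + j)))‖ₑ)
      Filter.atTop (nhds (0 : ℝ≥0∞)) ∧
    Filter.Tendsto
      (fun k => ⨆ h ∈ K, ∏ i ∈ Finset.Icc 1 (r k), ‖h (Φ^[i - 1] (b (j - i + 1)))‖ₑ⁻¹)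
      Filter.atTop (nhds (0 : ℝ≥0∞))

end Shift

/-! Necessity. On a compact set `K` of characters some `f` satisfies `2 ≤ ‖h f‖`. Let `v` carry `f`
at the indices in `I` and `0` elsewhere. A dense orbit supplies `y` and arbitrarily large `n` with
both `y` and `T_n y` close to `v`. For `j ∈ I` and `n` large, `v` vanishes at `j + n` and `j - n`.
At `j + n`, the small entry of `T_n y`, seen through `h ∘ Φ⁻ⁿ`, is the first weight product times `h
(y j)`, of modulus at least `1`; so that product is small. At `j`, the entry of `T_n y` has modulus
at least `1` under `h`, yet equals the second product times a value controlled by the small entry of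
`y` at `j - n`; so the inverse of that product is small.

Sufficiency. With a unit the character space is compact, so `K` may be all of it, and Gelfand theory
turns suprema over characters into norms. The condition at the single index `1` then says that,
along `r`, `T` sends sequences supported at `1` to `0` and that their preimages tend to `0`. Since
`T_n = T_1ⁿ` commutes with `T_1`, and invertible weights make `T_1` a bijection, bounded below,
between sequences supported at adjacent indices, both limits spread to every index. One-entry
sequences span a dense subspace, and the hypercyclicity criterion (a Baire argument) applies. -/

open scoped ENNReal
open Filter Topology

/-! ### Transitivity and the hypercyclicity criterion -/

/-- A topologically transitive sequence of bounded operators on a separable Banach space is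
hypercyclic. -/
theorem isHypercyclicSeq_of_transitive {X : Type*} [NormedAddCommGroup X] [NormedSpace ℂ X]
    [CompleteSpace X] [TopologicalSpace.SeparableSpace X] (T : ℕ → X →L[ℂ] X)
    (h : ∀ U V : Set X, IsOpen U → IsOpen V → U.Nonempty → V.Nonempty →
      ∃ n, (U ∩ T n ⁻¹' V).Nonempty) : IsHypercyclicSeq T := by
  have := UniformSpace.secondCountable_of_separable X
  have hB := TopologicalSpace.isBasis_countableBasis X
  -- Baire category: these are the vectors whose orbit meets every basic open set.
  have hd : Dense (⋂ V ∈ TopologicalSpace.countableBasis X, ⋃ n, T n ⁻¹' V) := by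
    refine dense_biInter_of_isOpen (fun V hV => isOpen_iUnion fun n =>
      (hB.isOpen hV).preimage (T n).continuous) (TopologicalSpace.countable_countableBasis X)
      fun V hV => dense_iff_inter_open.mpr fun U hU hUne => ?_
    obtain ⟨n, x, hxU, hxV⟩ := h U V hU (hB.isOpen hV) hUne
      (TopologicalSpace.nonempty_of_mem_countableBasis hV)
    exact ⟨x, hxU, Set.mem_iUnion.mpr ⟨n, hxV⟩⟩
  obtain ⟨x, hx⟩ := hd.nonempty
  refine ⟨x, hB.dense_iff.mpr fun V hV _ => ?_⟩
  obtain ⟨n, hn⟩ := Set.mem_iUnion.mp (Set.mem_iInter₂.mp hx V hV)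
  exact ⟨T n x, hn, n, rfl⟩

/-- The hypercyclicity criterion, with both conditions assumed on one total set `S`. -/
theorem isHypercyclicSeq_of_criterion {X : Type*} [NormedAddCommGroup X] [NormedSpace ℂ X]
    [CompleteSpace X] [TopologicalSpace.SeparableSpace X] (T : ℕ → X →L[ℂ] X) (r : ℕ → ℕ)
    (S : Set X) (hS : Dense (Submodule.span ℂ S : Set X))
    (h₁ : ∀ x ∈ S, Tendsto (fun k => T (r k) x) atTop (𝓝 0))
    (h₂ : ∀ x ∈ S, ∃ u : ℕ → X, Tendsto u atTop (𝓝 0) ∧ ∀ k, T (r k) (u k) = x) :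
    IsHypercyclicSeq T := by
  have H₁ : ∀ x ∈ Submodule.span ℂ S, Tendsto (fun k => T (r k) x) atTop (𝓝 0) := by
    intro x hx
    induction hx using Submodule.span_induction with
    | mem x hx => exact h₁ x hx
    | zero => simp
    | add x y _ _ hx hy => simpa using hx.add hy
    | smul c x _ hx => simpa using hx.const_smul c
  have H₂ : ∀ x ∈ Submodule.span ℂ S,
      ∃ u : ℕ → X, Tendsto u atTop (𝓝 0) ∧ ∀ k, T (r k) (u k) = x := by
    intro x hx
    induction hx using Submodule.span_induction with
    | mem x hx => exact h₂ x hx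
    | zero => exact ⟨fun _ => 0, tendsto_const_nhds, by simp⟩
    | add x y _ _ hx hy =>
      obtain ⟨u, hu, hu'⟩ := hx
      obtain ⟨v, hv, hv'⟩ := hy
      exact ⟨fun k => u k + v k, by simpa using hu.add hv, fun k => by simp [hu', hv']⟩
    | smul c x _ hx =>
      obtain ⟨u, hu, hu'⟩ := hx
      exact ⟨fun k => c • u k, by simpa using hu.const_smul c, fun k => by simp [hu']⟩
  refine isHypercyclicSeq_of_transitive T fun U V hU hV hUne hVne => ?_
  obtain ⟨x, hxU, hx⟩ := hS.inter_open_nonempty U hU hUne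
  obtain ⟨y, hyV, hy⟩ := hS.inter_open_nonempty V hV hVne
  obtain ⟨u, hu, hu'⟩ := H₂ y hy
  -- The point `x + u k` starts near `x` and lands near `y`: `T (r k)` kills `x` in the limit and
  -- sends `u k` to `y`.
  have e₁ : Tendsto (fun k => x + u k) atTop (𝓝 x) := by simpa using hu.const_add x
  have e₂ : Tendsto (fun k => T (r k) (x + u k)) atTop (𝓝 y) := by
    simpa [hu'] using (H₁ x hx).add_const y
  obtain ⟨k, hk₁, hk₂⟩ := ((e₁.eventually (hU.mem_nhds hxU)).and
    (e₂.eventually (hV.mem_nhds hyV))).exists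
  exact ⟨r k, x + u k, hk₁, hk₂⟩

/-! ### Characters of a commutative, possibly non-unital, C*-algebra -/

section Characters

variable {A : Type*} [NonUnitalCommCStarAlgebra A]

open WeakDual

/-- The unital extension of a character to the minimal unitization. -/
noncomputable def characterUnitization (h : characterSpace ℂ A) : Unitization ℂ A →ₐ[ℂ] ℂ :=
  Unitization.lift (CharacterSpace.toNonUnitalAlgHom h)

theorem characterUnitization_inr (h : characterSpace ℂ A) (a : A) :
    characterUnitization h (a : Unitization ℂ A) = h a := by
  simp [characterUnitization]

theorem norm_character_apply_le (h : characterSpace ℂ A) (a : A) : ‖h a‖ ≤ ‖a‖ := by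
  rw [← characterUnitization_inr, ← Unitization.norm_inr (𝕜 := ℂ) a]
  exact AlgHom.norm_apply_le_self (characterUnitization h) _

theorem character_apply_star (h : characterSpace ℂ A) (a : A) : h (star a) = star (h a) := by
  have := AlgHomClass.instStarHomClass (F := Unitization ℂ A →ₐ[ℂ] ℂ)
  rw [← characterUnitization_inr, ← characterUnitization_inr, Unitization.inr_star, map_star]

/-- The Gelfand transform of the unitization is isometric and its character space is compact, so the
norm is attained at some `χ`. Its restriction to `A` is nonzero because its value at `a` has modulus
`‖a‖ ≠ 0`. -/
theorem exists_character_norm_apply_eq {a : A} (ha : a ≠ 0) :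
    ∃ h : characterSpace ℂ A, ‖h a‖ = ‖a‖ := by
  have hne : Nonempty (characterSpace ℂ (Unitization ℂ A)) := inferInstance
  set F := gelfandTransform ℂ (Unitization ℂ A) (a : Unitization ℂ A)
  obtain ⟨χ, -, hχ⟩ := isCompact_univ.exists_isMaxOn Set.univ_nonempty F.continuous.norm.continuousOn
  have hn : ‖F‖ = ‖a‖ := by
    rw [(gelfandTransform_isometry (Unitization ℂ A)).norm_map_of_map_zero (map_zero _),
      Unitization.norm_inr]
  have hχ' : ‖χ (a : Unitization ℂ A)‖ = ‖a‖ := by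
    rw [← hn]
    exact le_antisymm (F.norm_coe_le_norm χ)
      ((ContinuousMap.norm_le _ (norm_nonneg _)).mpr fun χ' => hχ (Set.mem_univ χ'))
  let f : WeakDual ℂ A := StrongDual.toWeakDual
    (LinearMap.mkContinuous ((χ : Unitization ℂ A →ₗ[ℂ] ℂ) ∘ₗ (Unitization.inrHom ℂ ℂ A)) 1
      fun x => by
        have := AlgHom.norm_apply_le_self χ (x : Unitization ℂ A)
        rw [Unitization.norm_inr] at this
        simpa using this)
  have hf : ∀ x, f x = χ (x : Unitization ℂ A) := fun x => rfl
  refine ⟨⟨f, fun h0 => ha ?_, fun x y => ?_⟩, hχ'⟩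
  · rw [← norm_eq_zero, ← hχ', ← hf, h0]
    exact norm_zero
  · rw [hf, hf, hf, Unitization.inr_mul, map_mul]

/-- Characters take the value `1` at a unit, a closed condition that excludes the zero functional;
Banach–Alaoglu does the rest. -/
theorem isCompact_univ_characterSpace {e : A} (he : ∀ a, e * a = a) :
    IsCompact (Set.univ : Set (characterSpace ℂ A)) := by
  have h1 : ∀ h : characterSpace ℂ A, h e = 1 := fun h => by
    obtain ⟨a, ha⟩ : ∃ a, h a ≠ 0 := by
      by_contra! h0
      exact h.2.1 (DFunLike.ext _ _ h0)
    have := congrArg h (he a)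
    rw [map_mul] at this
    exact mul_right_cancel₀ ha (by rw [this, one_mul])
  have hset : characterSpace ℂ A = (characterSpace ℂ A ∪ {0}) ∩ {φ | φ e = 1} := by
    ext φ
    constructor
    · exact fun hφ => ⟨Or.inl hφ, h1 ⟨φ, hφ⟩⟩
    · rintro ⟨hφ | hφ, h⟩
      · exact hφ
      · rw [Set.mem_singleton_iff] at hφ
        rw [Set.mem_ofPred_eq, hφ] at h
        exact absurd h.symm one_ne_zero
  rw [← isCompact_iff_isCompact_univ]
  refine isCompact_of_bounded_of_closed ?_ ?_
  · refine (isBounded_closedBall (0 : StrongDual ℂ A) 1).subset fun φ hφ => ?_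
    simp only [Set.mem_preimage, Metric.mem_closedBall, dist_zero_right]
    exact ContinuousLinearMap.opNorm_le_bound _ zero_le_one fun a => by
      rw [one_mul]
      exact norm_character_apply_le ⟨φ, hφ⟩ a
  · rw [hset]
    exact (CharacterSpace.union_zero_isClosed (𝕜 := ℂ) (A := A)).inter
      (isClosed_singleton.preimage (WeakDual.eval_continuous e))

theorem character_fold (h : characterSpace ℂ A) (s : Finset ℕ) (x : A) (c : ℕ → A) :
    h (s.fold (fun u v : A => u * v) x c) = (∏ k ∈ s, h (c k)) * h x := by
  classical
  induction s using Finset.induction_on with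
  | empty => simp
  | insert a s ha ih => rw [Finset.fold_insert ha, Finset.prod_insert ha, map_mul, ih, mul_assoc]

/-- On a compact set of characters some element of the algebra is bounded away from zero. -/
theorem exists_one_le_norm_character {K : Set (characterSpace ℂ A)} (hK : IsCompact K) :
    ∃ f : A, ∀ h ∈ K, 1 ≤ ‖h f‖ := by
  have hex : ∀ h : characterSpace ℂ A, ∃ a : A, 1 < ‖h a‖ := fun h => by
    obtain ⟨a, ha⟩ : ∃ a, h a ≠ 0 := by
      by_contra! h0
      exact h.2.1 (DFunLike.ext _ _ h0)
    refine ⟨(2 / h a) • a, ?_⟩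
    rw [map_smul, smul_eq_mul, div_mul_cancel₀ _ ha]
    norm_num
  choose g hg using hex
  have hcont : ∀ a : A, Continuous fun h : characterSpace ℂ A => h a := fun a =>
    (WeakDual.eval_continuous a).comp continuous_subtype_val
  obtain ⟨t, -, ht⟩ := hK.elim_nhds_subcover (fun h => {h' | 1 < ‖h' (g h)‖}) fun h _ =>
    (isOpen_lt continuous_const (hcont (g h)).norm).mem_nhds (hg h)
  -- Terms of the form `star g * g` are nonnegative under characters, so nothing cancels the term
  -- that exceeds `1`.
  refine ⟨∑ h ∈ t, star (g h) * g h, fun h hh => ?_⟩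
  obtain ⟨h', hh't, hh'⟩ := Set.mem_iUnion₂.mp (ht hh)
  have hval : h (∑ h ∈ t, star (g h) * g h) = ((∑ i ∈ t, ‖h (g i)‖ ^ 2 : ℝ) : ℂ) := by
    rw [map_sum]
    push_cast
    refine Finset.sum_congr rfl fun i _ => ?_
    rw [map_mul, character_apply_star, Complex.star_def, Complex.conj_mul']
  rw [hval, Complex.norm_real, Real.norm_of_nonneg (by positivity)]
  have h1 : 1 < ‖h (g h')‖ := hh'
  calc (1 : ℝ) ≤ ‖h (g h')‖ ^ 2 := by nlinarith
    _ ≤ _ := Finset.single_le_sum (f := fun i => ‖h (g i)‖ ^ 2) (fun i _ => by positivity) hh't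

end Characters

/-! ### Completeness and separability of the standard module -/

namespace StdHilbertModule

variable {A : Type*} [NonUnitalCommCStarAlgebra A]

/-- Parallelogram law, with the positive term coming from `x j - y j` dropped. -/
theorem norm_sum_star_mul_add_le (s : Finset ℤ) (x y : ℤ → A) :
    ‖∑ j ∈ s, star (x j + y j) * (x j + y j)‖
      ≤ 2 * (‖∑ j ∈ s, star (x j) * x j‖ + ‖∑ j ∈ s, star (y j) * y j‖) := by
  let _ := CStarAlgebra.spectralOrder A
  have _ := CStarAlgebra.spectralOrderedRing A
  have h : ∑ j ∈ s, star (x j + y j) * (x j + y j)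
      ≤ (2 : ℝ) • (∑ j ∈ s, star (x j) * x j + ∑ j ∈ s, star (y j) * y j) := by
    rw [← Finset.sum_add_distrib, Finset.smul_sum]
    refine Finset.sum_le_sum fun j _ => ?_
    rw [← sub_nonneg]
    have h : (2 : ℝ) • (star (x j) * x j + star (y j) * y j)
        - star (x j + y j) * (x j + y j) = star (x j - y j) * (x j - y j) := by
      simp only [star_add, star_sub, add_mul, mul_add, sub_mul, mul_sub, two_smul]
      abel
    rw [h]
    exact star_mul_self_nonneg _
  refine (CStarAlgebra.norm_le_norm_of_nonneg_of_le
    (Finset.sum_nonneg fun _ _ => star_mul_self_nonneg _) h).trans ?_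
  rw [norm_smul, Real.norm_of_nonneg zero_le_two]
  gcongr
  exact norm_add_le _ _

theorem norm_sq (x : StdHilbertModule A) : ‖x‖ ^ 2 = ‖∑' j, star (x j) * x j‖ := by
  rw [norm_def, Real.sq_sqrt (norm_nonneg _)]

theorem norm_sum_le_norm_sq (x : StdHilbertModule A) (s : Finset ℤ) :
    ‖∑ j ∈ s, star (x j) * x j‖ ≤ ‖x‖ ^ 2 := by
  let _ := CStarAlgebra.spectralOrder A
  have _ := CStarAlgebra.spectralOrderedRing A
  rw [norm_sq]
  exact CStarAlgebra.norm_le_norm_of_nonneg_of_le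
    (Finset.sum_nonneg fun _ _ => star_mul_self_nonneg _)
    (x.summable.sum_le_tsum s fun _ _ => star_mul_self_nonneg _)

theorem norm_le_of_forall_norm_sum_le {x : StdHilbertModule A} {C : ℝ} (hC : 0 ≤ C)
    (h : ∀ s : Finset ℤ, ‖∑ j ∈ s, star (x j) * x j‖ ≤ C ^ 2) : ‖x‖ ≤ C := by
  refine le_of_sq_le_sq ?_ hC
  rw [norm_sq]
  exact le_of_tendsto x.summable.hasSum.norm (Eventually.of_forall h)

theorem norm_apply_le (x : StdHilbertModule A) (j : ℤ) : ‖x j‖ ≤ ‖x‖ := by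
  refine le_of_sq_le_sq ?_ (norm_nonneg x)
  simpa [CStarRing.norm_star_mul_self, sq] using norm_sum_le_norm_sq x {j}

@[simp] theorem sub_apply (a b : StdHilbertModule A) (j : ℤ) : (a - b) j = a j - b j := rfl

@[simp] theorem sum_apply {ι : Type*} (s : Finset ι) (f : ι → StdHilbertModule A) (j : ℤ) :
    (∑ i ∈ s, f i) j = ∑ i ∈ s, f i j := by
  classical
  induction s using Finset.induction_on with
  | empty => rfl
  | insert a s ha ih => rw [Finset.sum_insert ha, Finset.sum_insert ha, add_apply, ih]

/-- The sequence with the entry `a` at `j` and zeros elsewhere. -/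
noncomputable def single (j : ℤ) (a : A) : StdHilbertModule A :=
  ⟨Pi.single j a, summable_of_ne_finset_zero (s := {j}) fun i hi => by
    rw [Pi.single_eq_of_ne (by simpa using hi), mul_zero]⟩

theorem single_apply (j : ℤ) (a : A) (i : ℤ) : single j a i = if i = j then a else 0 :=
  Pi.single_apply j a i

@[simp] theorem single_same (j : ℤ) (a : A) : single j a j = a := by simp [single_apply]

theorem single_of_ne {j i : ℤ} (h : i ≠ j) (a : A) : single j a i = 0 := by
  simp [single_apply, h]

@[simp] theorem norm_single (j : ℤ) (a : A) : ‖single j a‖ = ‖a‖ := by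
  rw [norm_def, tsum_eq_single j fun i hi => by rw [single_of_ne hi, mul_zero], single_same,
    CStarRing.norm_star_mul_self, Real.sqrt_mul_self (norm_nonneg _)]

theorem single_sub (j : ℤ) (a b : A) : single j (a - b) = single j a - single j b := by
  ext i
  by_cases h : i = j <;> simp [single_apply, h]

theorem continuous_single (j : ℤ) : Continuous (single j : A → StdHilbertModule A) :=
  (Isometry.of_dist_eq fun a b => by
    rw [dist_eq_norm, dist_eq_norm, ← single_sub, norm_single]).continuous

instance : CompleteSpace (StdHilbertModule A) := by
  refine Metric.complete_of_cauchySeq_tendsto fun u hu => ?_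
  have hcoord : ∀ j, ∃ a, Tendsto (fun n => u n j) atTop (𝓝 a) := fun j => by
    refine cauchySeq_tendsto_of_complete (Metric.cauchySeq_iff.mpr fun ε hε => ?_)
    obtain ⟨N, hN⟩ := Metric.cauchySeq_iff.mp hu ε hε
    refine ⟨N, fun m hm n hn => ?_⟩
    have h := norm_apply_le (u m - u n) j
    rw [sub_apply, ← dist_eq_norm, ← dist_eq_norm] at h
    exact h.trans_lt (hN m hm n hn)
  choose a ha using hcoord
  -- The bound is uniform over finite sets `s`: for fixed `s` the limit in `m` is a finite sum of
  -- coordinate limits. This gives both membership of the limit and convergence in norm.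
  have hlim : ∀ ε > 0, ∃ N, ∀ n ≥ N, ∀ s : Finset ℤ,
      ‖∑ j ∈ s, star (u n j - a j) * (u n j - a j)‖ ≤ ε ^ 2 := by
    intro ε hε
    obtain ⟨N, hN⟩ := Metric.cauchySeq_iff.mp hu ε hε
    refine ⟨N, fun n hn s => ?_⟩
    have ht : Tendsto (fun m => ‖∑ j ∈ s, star (u n j - u m j) * (u n j - u m j)‖) atTop
        (𝓝 ‖∑ j ∈ s, star (u n j - a j) * (u n j - a j)‖) := by
      refine (tendsto_finsetSum _ fun j _ => ?_).norm
      have h := (ha j).const_sub (u n j)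
      exact h.star.mul h
    refine le_of_tendsto ht ((eventually_ge_atTop N).mono fun m hm => ?_)
    refine (norm_sum_le_norm_sq (u n - u m) s).trans ?_
    rw [← dist_eq_norm]
    exact pow_le_pow_left₀ dist_nonneg (hN n hn m hm).le 2
  have hsum : Summable fun j => star (a j) * a j := by
    rw [summable_iff_vanishing_norm]
    intro ε hε
    -- The parallelogram bound yields `2 * (ε / 5 + ε / 5) < ε`.
    obtain ⟨N, hN⟩ := hlim (√(ε / 5)) (by positivity)
    obtain ⟨s, hs⟩ := summable_iff_vanishing_norm.mp (u N).summable (ε / 5) (by positivity)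
    refine ⟨s, fun t ht => ?_⟩
    have h := norm_sum_star_mul_add_le t (fun j => a j - u N j) (u N)
    simp only [sub_add_cancel] at h
    have h1 := hN N le_rfl t
    have h2 : ∀ j, star (u N j - a j) * (u N j - a j) = star (a j - u N j) * (a j - u N j) :=
      fun j => by rw [← neg_sub, star_neg, neg_mul_neg]
    simp only [h2] at h1
    rw [Real.sq_sqrt (by positivity)] at h1
    linarith [hs t ht]
  let y : StdHilbertModule A := ⟨a, hsum⟩
  refine ⟨y, Metric.tendsto_atTop'.mpr fun ε hε => ?_⟩
  obtain ⟨N, hN⟩ := hlim (ε / 2) (by positivity)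
  refine ⟨N, fun n hn => ?_⟩
  rw [dist_eq_norm]
  refine (norm_le_of_forall_norm_sum_le (by positivity) (hN n hn.le)).trans_lt (by linarith)

theorem dense_span_single :
    Dense (Submodule.span ℂ {x : StdHilbertModule A | ∃ j a, x = single j a} :
      Set (StdHilbertModule A)) := by
  intro x
  rw [Metric.mem_closure_iff]
  intro ε hε
  obtain ⟨s, hs⟩ := summable_iff_vanishing_norm.mp x.summable ((ε / 2) ^ 2) (by positivity)
  refine ⟨∑ i ∈ s, single i (x i), Submodule.sum_mem _ fun i _ =>
    Submodule.subset_span ⟨i, x i, rfl⟩, ?_⟩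
  rw [dist_eq_norm]
  refine (norm_le_of_forall_norm_sum_le (C := ε / 2) (by positivity) fun t => ?_).trans_lt
    (by linarith)
  have h : ∀ j, (x - ∑ i ∈ s, single i (x i)) j = if j ∈ s then 0 else x j := fun j => by
    simp only [sub_apply, sum_apply, single_apply, Finset.sum_ite_eq]
    split_ifs <;> simp
  have h2 : ∑ j ∈ t, star ((x - ∑ i ∈ s, single i (x i)) j) * (x - ∑ i ∈ s, single i (x i)) j
      = ∑ j ∈ t \ s, star (x j) * x j := by
    rw [Finset.sdiff_eq_filter, Finset.sum_filter]
    refine Finset.sum_congr rfl fun j _ => ?_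
    rw [h]
    by_cases hj : j ∈ s <;> simp [hj]
  rw [h2]
  exact (hs _ Finset.sdiff_disjoint).le

theorem separableSpace [TopologicalSpace.SeparableSpace A] :
    TopologicalSpace.SeparableSpace (StdHilbertModule A) := by
  have h : {x : StdHilbertModule A | ∃ j a, x = single j a}
      = ⋃ j : ℤ, Set.range (single j) := by
    ext x
    simp [eq_comm]
  have hsep := (TopologicalSpace.IsSeparable.iUnion fun j : ℤ =>
    TopologicalSpace.isSeparable_range (continuous_single (A := A) j)).span (R := ℂ)
  rw [← h] at hsep
  refine TopologicalSpace.isSeparable_univ_iff.mp ?_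
  rw [← dense_span_single.closure_eq]
  exact hsep.closure

end StdHilbertModule

theorem enorm_finsetProd_complex {ι : Type*} (s : Finset ι) (g : ι → ℂ) :
    ‖∏ i ∈ s, g i‖ₑ = ∏ i ∈ s, ‖g i‖ₑ := by
  classical
  induction s using Finset.induction_on with
  | empty => simp
  | insert a s ha ih => rw [Finset.prod_insert ha, Finset.prod_insert ha, enorm_mul, ih]

/-! ### Semigroup law of the shifts and their values under characters -/

section ShiftAlgebra

variable {A : Type*} [NonUnitalCommCStarAlgebra A] (Φ : A ≃⋆ₐ[ℂ] A) (b : ℤ → A)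
  (hb : BddAbove (Set.range fun j => ‖b j‖))

open StdHilbertModule WeakDual

theorem iterate_fold_mul (n : ℕ) (s : Finset ℕ) (x : A) (c : ℕ → A) :
    Φ^[n] (s.fold (fun u v : A => u * v) x c)
      = s.fold (fun u v : A => u * v) (Φ^[n] x) fun k => Φ^[n] (c k) := by
  classical
  induction s using Finset.induction_on with
  | empty => simp
  | insert a s ha ih => rw [Finset.fold_insert ha, Finset.fold_insert ha, iterate_map_mul, ih]

theorem symm_iterate_iterate {n k : ℕ} (h : k ≤ n) (x : A) :
    Φ.symm^[n] (Φ^[n - k] x) = Φ.symm^[k] x := by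
  have hinv : Function.LeftInverse Φ.symm Φ := Φ.symm_apply_apply
  obtain ⟨m, rfl⟩ := Nat.exists_eq_add_of_le h
  rw [Nat.add_sub_cancel_left, Function.iterate_add_apply, hinv.iterate m]

theorem iterate_symm_iterate (n : ℕ) (x : A) : Φ^[n] (Φ.symm^[n] x) = x :=
  Function.LeftInverse.iterate (f := Φ.symm) (g := Φ) Φ.apply_symm_apply n x

theorem genBilateralShift_one_apply (a : StdHilbertModule A) (j : ℤ) :
    genBilateralShift Φ b hb 1 a j = b j * Φ (a (j - 1)) := by
  simp [genBilateralShift_apply]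

theorem genBilateralShift_zero : genBilateralShift Φ b hb 0 = ContinuousLinearMap.id ℂ _ := by
  refine ContinuousLinearMap.ext fun a => StdHilbertModule.ext fun j => ?_
  simp [genBilateralShift_apply]

/-- Applying `Φ` raises each exponent `n - k` by one, and the new weight `b j` is the factor `k = n
+ 1`, with exponent `0`. -/
theorem genBilateralShift_one_genBilateralShift (n : ℕ) (a : StdHilbertModule A) :
    genBilateralShift Φ b hb 1 (genBilateralShift Φ b hb n a)
      = genBilateralShift Φ b hb (n + 1) a := by
  ext j
  rw [genBilateralShift_one_apply, genBilateralShift_apply, genBilateralShift_apply,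
    ← Finset.insert_Icc_right_eq_Icc_add_one (by omega), Finset.fold_insert (by simp)]
  have h := iterate_fold_mul Φ 1 (Finset.Icc 1 n) (Φ^[n] (a (j - 1 - n)))
    fun k => Φ^[n - k] (b (j - 1 - n + k))
  rw [Function.iterate_one] at h
  rw [h, Nat.sub_self, Function.iterate_zero_apply, ← Function.iterate_succ_apply' Φ]
  congr 1
  · congr 1
    push_cast
    ring
  · rw [show j - 1 - (n : ℤ) = j - ((n + 1 : ℕ) : ℤ) by push_cast; ring]
    refine Finset.fold_congr fun k hk => ?_
    rw [← Function.iterate_succ_apply' Φ, Nat.succ_sub (Finset.mem_Icc.mp hk).2]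

theorem genBilateralShift_comp (m n : ℕ) (a : StdHilbertModule A) :
    genBilateralShift Φ b hb m (genBilateralShift Φ b hb n a)
      = genBilateralShift Φ b hb (m + n) a := by
  induction m with
  | zero => simp [genBilateralShift_zero]
  | succ m ih =>
    rw [← genBilateralShift_one_genBilateralShift, ih, genBilateralShift_one_genBilateralShift,
      Nat.add_right_comm]

theorem genBilateralShift_single (n : ℕ) (j : ℤ) (a : A) :
    genBilateralShift Φ b hb n (single j a)
      = single (j + n) (genBilateralShift Φ b hb n (single j a) (j + n)) := by
  ext i
  by_cases h : i = j + n
  · subst h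
    rw [single_same]
  · rw [single_of_ne h, genBilateralShift_apply, single_of_ne (by omega)]
    have h0 := fold_mul_smul (Finset.Icc 1 n) (fun k => Φ^[n - k] (b (i - n + k))) 0 (0 : A)
    rw [zero_smul, zero_smul] at h0
    rw [iterate_map_zero, h0]

/-- Undoing `Φ^n` turns `Φ^(n-k)` into `Φ^(-k)`, which produces the first product of the weight
condition. -/
theorem enorm_character_symm_genBilateralShift (h : characterSpace ℂ A) (n : ℕ)
    (a : StdHilbertModule A) (j : ℤ) :
    ‖h (Φ.symm^[n] (genBilateralShift Φ b hb n a (j + n)))‖ₑ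
      = (∏ i ∈ Finset.Icc 1 n, ‖h (Φ.symm^[i] (b (i + j)))‖ₑ) * ‖h (a j)‖ₑ := by
  rw [genBilateralShift_apply, iterate_fold_mul, character_fold, enorm_mul, add_sub_cancel_right]
  rw [enorm_finsetProd_complex]
  congr 1
  · refine Finset.prod_congr rfl fun k hk => ?_
    rw [symm_iterate_iterate Φ (Finset.mem_Icc.mp hk).2, add_comm]
  · have := symm_iterate_iterate Φ (Nat.zero_le n) (a j)
    rw [Nat.sub_zero] at this
    rw [this, Function.iterate_zero_apply]

/-- The substitution `i = n + 1 - k` produces the second product of the weight condition. -/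
theorem enorm_character_genBilateralShift (h : characterSpace ℂ A) (n : ℕ)
    (a : StdHilbertModule A) (j : ℤ) :
    ‖h (genBilateralShift Φ b hb n a j)‖ₑ
      = (∏ i ∈ Finset.Icc 1 n, ‖h (Φ^[i - 1] (b (j - i + 1)))‖ₑ)
        * ‖h (Φ^[n] (a (j - n)))‖ₑ := by
  rw [genBilateralShift_apply, character_fold, enorm_mul]
  rw [enorm_finsetProd_complex]
  congr 1
  refine Finset.prod_nbij' (fun k => n + 1 - k) (fun k => n + 1 - k) ?_ ?_ ?_ ?_ ?_
  all_goals intro k hk; rw [Finset.mem_Icc] at hk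
  · exact Finset.mem_Icc.mpr (by omega)
  · exact Finset.mem_Icc.mpr (by omega)
  · omega
  · omega
  · rw [show n + 1 - k - 1 = n - k by omega,
      show j - ((n + 1 - k : ℕ) : ℤ) + 1 = j - n + k by omega]

end ShiftAlgebra

/-! ### Hypercyclicity implies the weight condition -/

section Main

variable {A : Type*} [NonUnitalCommCStarAlgebra A] {Φ : A ≃⋆ₐ[ℂ] A} {b : ℤ → A}
  {hb : BddAbove (Set.range fun j => ‖b j‖)}

open StdHilbertModule WeakDual

theorem enorm_character_apply_le (h : characterSpace ℂ A) (a : A) : ‖h a‖ₑ ≤ ‖a‖ₑ :=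
  enorm_le_iff_norm_le.mpr (norm_character_apply_le h a)

theorem enorm_symm_iterate (Φ : A ≃⋆ₐ[ℂ] A) (n : ℕ) (a : A) : ‖Φ.symm^[n] a‖ₑ = ‖a‖ₑ := by
  rw [← ofReal_norm, ← ofReal_norm, norm_iterate_starAlgEquiv]

/-- For a hypercyclic shift, every vector `v` is approximated by some `y` which returns near `v`
at arbitrarily late times. -/
theorem exists_near_recurrent [Nontrivial A]
    (hT : IsHypercyclicSeq (genBilateralShift Φ b hb)) (v : StdHilbertModule A) {δ : ℝ}
    (hδ : 0 < δ) (N : ℕ) :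
    ∃ y : StdHilbertModule A, ∃ n ≥ N, ‖y - v‖ < δ ∧ ‖genBilateralShift Φ b hb n y - v‖ < δ := by
  obtain ⟨x, hx⟩ := hT
  obtain ⟨a, ha⟩ := exists_ne (0 : A)
  have : Nontrivial (StdHilbertModule A) :=
    ⟨single 0 a, 0, fun h => ha (by simpa using congrArg (fun y : StdHilbertModule A => y 0) h)⟩
  have := Module.punctured_nhds_neBot ℂ (StdHilbertModule A)
  obtain ⟨_, ⟨m, rfl⟩, hm⟩ := Metric.dense_iff.mp hx v δ hδ |>.imp fun _ h => h.symm
  -- Without isolated points, a dense set stays dense after removing finitely many points, so the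
  -- orbit of `x` returns near `v` at some time `n ≥ m + N`. Then `y = T_m x` works with return time
  -- `n - m`.
  obtain ⟨_, hn, ⟨n, rfl⟩, hn'⟩ := Metric.dense_iff.mp (hx.sdiff_finite
    ((Set.finite_Iio (m + N)).image fun n => genBilateralShift Φ b hb n x)) v δ hδ
  have hle : m + N ≤ n := by
    by_contra! hlt
    exact hn' ⟨n, hlt, rfl⟩
  refine ⟨genBilateralShift Φ b hb m x, n - m, by omega, ?_, ?_⟩
  · rw [← dist_eq_norm]
    exact hm
  · rw [genBilateralShift_comp, Nat.sub_add_cancel (by omega), ← dist_eq_norm]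
    exact hn

theorem weightCondition_of_isHypercyclicSeq
    (hT : IsHypercyclicSeq (genBilateralShift Φ b hb)) : WeightCondition Φ b := by
  intro K hKne hK I hI hIpos
  obtain ⟨h₀, hh₀⟩ := hKne
  have : Nontrivial A := by
    by_contra h
    rw [not_nontrivial_iff_subsingleton] at h
    exact (CharacterSpace.instIsEmpty (𝕜 := ℂ) (A := A)).false h₀
  obtain ⟨f', hf'⟩ := exists_one_le_norm_character hK
  -- The bound `2` leaves modulus at least `1` after a perturbation of size `δ ≤ 1`.
  obtain ⟨f, hf⟩ : ∃ f : A, ∀ h ∈ K, 2 ≤ ‖h f‖ := ⟨(2 : ℂ) • f', fun h hh => by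
    rw [map_smul, norm_smul, Complex.norm_ofNat]
    linarith [hf' h hh]⟩
  set v : StdHilbertModule A := ∑ j ∈ I, single (j : ℤ) f
  have hv : ∀ j ∈ I, v j = f := fun j hj => by
    simp only [v, StdHilbertModule.sum_apply, single_apply, Nat.cast_inj, Finset.sum_ite_eq, if_pos hj]
  have hv0 : ∀ i : ℤ, (∀ j ∈ I, i ≠ j) → v i = 0 := fun i hi => by
    simp only [v, StdHilbertModule.sum_apply]
    exact Finset.sum_eq_zero fun j hj => single_of_ne (hi j hj) f
  -- One `n` serves all `j ∈ I` and both suprema; having such `n` arbitrarily late permits a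
  -- strictly increasing choice.
  have key : ∀ k : ℕ, ∃ᶠ n in atTop, 0 < n ∧ ∀ j ∈ I,
      (⨆ h ∈ K, ∏ i ∈ Finset.Icc 1 n, ‖h (Φ.symm^[i] (b (i + j)))‖ₑ)
        ≤ ENNReal.ofReal (1 / (k + 1)) ∧
      (⨆ h ∈ K, ∏ i ∈ Finset.Icc 1 n, ‖h (Φ^[i - 1] (b (j - i + 1)))‖ₑ⁻¹)
        ≤ ENNReal.ofReal (1 / (k + 1)) := by
    intro k
    rw [frequently_atTop]
    intro N
    set δ : ℝ := 1 / (k + 1)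
    have hδ : 0 < δ := by positivity
    have hδ1 : δ ≤ 1 := by
      rw [div_le_one (by positivity)]
      linarith [k.cast_nonneg (α := ℝ)]
    -- Taking `n` beyond `I` puts `j + n` above `I` and makes `j - n` negative, so `v` vanishes at
    -- both.
    obtain ⟨y, n, hn, hy, hTy⟩ := exists_near_recurrent hT v hδ (max (N + 1) (I.sup id + 1))
    have hIn : ∀ j ∈ I, j < n := fun j hj => by
      have := Finset.le_sup (f := id) hj
      simp only [id] at this
      omega
    have hy' : ∀ i, ‖y i - v i‖ ≤ δ := fun i => (norm_apply_le (y - v) i).trans hy.le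
    have hTy' : ∀ i, ‖genBilateralShift Φ b hb n y i - v i‖ ≤ δ := fun i =>
      (norm_apply_le (genBilateralShift Φ b hb n y - v) i).trans hTy.le
    have hbig : ∀ h ∈ K, ∀ z : A, ‖z - f‖ ≤ δ → 1 ≤ ‖h z‖ₑ := fun h hh z hz => by
      have h1 := (norm_character_apply_le h (z - f)).trans hz
      rw [map_sub] at h1
      have h2 := norm_sub_norm_le (h f) (h z)
      rw [norm_sub_rev] at h2
      have h3 : 1 ≤ ‖h z‖ := by linarith [hf h hh]
      rw [← ofReal_norm]
      exact ENNReal.one_le_ofReal.mpr h3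
    have hsmall : ∀ z : A, ‖z‖ ≤ δ → ‖z‖ₑ ≤ ENNReal.ofReal δ := fun z hz => by
      rw [← ofReal_norm]
      exact ENNReal.ofReal_le_ofReal hz
    refine ⟨n, by omega, by omega, fun j hj => ⟨iSup₂_le fun h hh => ?_, iSup₂_le fun h hh => ?_⟩⟩
    · have h1 := hbig h hh (y j) (by simpa [hv j hj] using hy' j)
      have h2 := hTy' (j + n)
      rw [hv0 _ (fun i hi => by have := hIn i hi; omega), sub_zero] at h2
      calc _ ≤ (∏ i ∈ Finset.Icc 1 n, ‖h (Φ.symm^[i] (b (i + j)))‖ₑ) * ‖h (y j)‖ₑ :=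
            le_mul_of_one_le_right' h1
        _ ≤ ENNReal.ofReal δ := by
            rw [← enorm_character_symm_genBilateralShift Φ b hb]
            refine (enorm_character_apply_le h _).trans ?_
            rw [enorm_symm_iterate]
            exact hsmall _ h2
    · have h1 := hbig h hh (genBilateralShift Φ b hb n y j) (by simpa [hv j hj] using hTy' j)
      have h2 := hy' (j - n)
      rw [hv0 _ (fun i hi => by have := hIn j hj; have := hIpos i hi; omega), sub_zero] at h2
      rw [enorm_character_genBilateralShift] at h1
      have h3 : ‖h (Φ^[n] (y (j - n)))‖ₑ ≤ ENNReal.ofReal δ :=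
        (enorm_character_apply_le h _).trans
          (hsmall _ (by rwa [norm_iterate_starAlgEquiv]))
      -- With `P` the product, `1 ≤ P * δ` gives `P⁻¹ ≤ δ`; in particular `P` cannot vanish.
      rw [← ENNReal.prod_inv_distrib fun i _ j _ _ => Or.inr enorm_ne_top]
      refine ENNReal.inv_le_iff_le_mul (fun _ => ?_) (fun _ => ?_) |>.mpr
        (h1.trans (mul_le_mul_right h3 _))
      · exact absurd ‹_› ENNReal.ofReal_ne_top
      · exact ENNReal.ofReal_ne_zero_iff.mpr hδ
  obtain ⟨r, hr, hr'⟩ := extraction_forall_of_frequently key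
  have hlim : Tendsto (fun k : ℕ => ENNReal.ofReal (1 / (k + 1))) atTop (𝓝 0) := by
    simpa using ENNReal.tendsto_ofReal tendsto_one_div_add_atTop_nhds_zero_nat
  refine ⟨r, hr, fun k => (hr' k).1, fun j hj => ⟨?_, ?_⟩⟩
  · exact tendsto_of_tendsto_of_tendsto_of_le_of_le tendsto_const_nhds hlim
      (fun _ => zero_le) fun k => ((hr' k).2 j hj).1
  · exact tendsto_of_tendsto_of_tendsto_of_le_of_le tendsto_const_nhds hlim
      (fun _ => zero_le) fun k => ((hr' k).2 j hj).2

/-! ### The weight condition implies hypercyclicity -/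

theorem tendsto_zero_of_enorm_le_mul {X : Type*} [NormedAddCommGroup X] {u : ℕ → X} {s : ℕ → ℝ≥0∞}
    (hs : Tendsto s atTop (𝓝 0)) {C : ℝ≥0∞} (hC : C ≠ ∞) (hu : ∀ k, ‖u k‖ₑ ≤ s k * C) :
    Tendsto u atTop (𝓝 0) := by
  rw [tendsto_zero_iff_enorm_tendsto_zero]
  have h := ENNReal.Tendsto.mul_const hs (Or.inr hC)
  rw [zero_mul] at h
  exact tendsto_of_tendsto_of_tendsto_of_le_of_le tendsto_const_nhds h (fun _ => zero_le) hu

theorem genBilateralShift_one_single (j : ℤ) (a : A) :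
    genBilateralShift Φ b hb 1 (single j a) = single (j + 1) (b (j + 1) * Φ a) := by
  rw [genBilateralShift_single]
  simp [genBilateralShift_one_apply]

theorem genBilateralShift_one_single_symm {e : A} (he : ∀ a, e * a = a) {c : ℤ → A}
    (hc : ∀ j, b j * c j = e) (j : ℤ) (a : A) :
    genBilateralShift Φ b hb 1 (single j (Φ.symm (c (j + 1) * a))) = single (j + 1) a := by
  rw [genBilateralShift_one_single, Φ.apply_symm_apply, ← mul_assoc, hc, he]

theorem genBilateralShift_one_injective {e : A} (he : ∀ a, e * a = a) {c : ℤ → A}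
    (hc : ∀ j, b j * c j = e) : Function.Injective (genBilateralShift Φ b hb 1) := by
  intro x y h
  ext j
  have h1 := congrArg (fun z : StdHilbertModule A => c (j + 1) * z (j + 1)) h
  simp only [genBilateralShift_one_apply, add_sub_cancel_right, ← mul_assoc] at h1
  rw [mul_comm (c (j + 1)), hc, he, he] at h1
  exact EquivLike.injective Φ h1

theorem exists_genBilateralShift_single_eq {e : A} (he : ∀ a, e * a = a) {c : ℤ → A}
    (hc : ∀ j, b j * c j = e) (n : ℕ) (j : ℤ) (a : A) :
    ∃ x, genBilateralShift Φ b hb n (single (j - n) x) = single j a := by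
  induction n generalizing j a with
  | zero => exact ⟨a, by simp [genBilateralShift_zero]⟩
  | succ n ih =>
    obtain ⟨x, hx⟩ := ih (j - 1) (Φ.symm (c (j - 1 + 1) * a))
    refine ⟨x, ?_⟩
    rw [← genBilateralShift_one_genBilateralShift,
      show j - ((n + 1 : ℕ) : ℤ) = j - 1 - n by push_cast; ring, hx,
      genBilateralShift_one_single_symm he hc, sub_add_cancel]

/-- The image has a single entry. Its norm is unchanged by `Φ^(-n)` and attained at a character,
where the weight product appears. -/
theorem enorm_genBilateralShift_single_le (n : ℕ) (j : ℤ) (a : A) :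
    ‖genBilateralShift Φ b hb n (single j a)‖ₑ
      ≤ (⨆ h ∈ (Set.univ : Set (characterSpace ℂ A)),
        ∏ i ∈ Finset.Icc 1 n, ‖h (Φ.symm^[i] (b (i + j)))‖ₑ) * ‖a‖ₑ := by
  set z := genBilateralShift Φ b hb n (single j a) (j + n) with hz
  rw [genBilateralShift_single, ← hz, ← ofReal_norm, norm_single, ofReal_norm,
    ← enorm_symm_iterate Φ n]
  by_cases h0 : Φ.symm^[n] z = 0
  · simp [h0]
  obtain ⟨h, hh⟩ := exists_character_norm_apply_eq h0
  rw [← ofReal_norm, ← hh, ofReal_norm, hz, enorm_character_symm_genBilateralShift, single_same]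
  exact mul_le_mul' (le_iSup₂ (f := fun (h : characterSpace ℂ A) (_ : h ∈ Set.univ) =>
    ∏ i ∈ Finset.Icc 1 n, ‖h (Φ.symm^[i] (b (i + j)))‖ₑ) h (Set.mem_univ h))
    (enorm_character_apply_le h a)

/-- At a character attaining the norm of `Φ^n x`, the equation reads `P * ‖h (Φ^n x)‖ₑ = ‖h a‖ₑ`
with `P` finite and nonzero. No formula for the preimage `x` is needed. -/
theorem enorm_le_of_genBilateralShift_single_eq {e : A} (he : ∀ a, e * a = a) {c : ℤ → A}
    (hc : ∀ j, b j * c j = e) {n : ℕ} {j : ℤ} {x a : A}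
    (hx : genBilateralShift Φ b hb n (single (j - n) x) = single j a) :
    ‖x‖ₑ ≤ (⨆ h ∈ (Set.univ : Set (characterSpace ℂ A)),
      ∏ i ∈ Finset.Icc 1 n, ‖h (Φ^[i - 1] (b (j - i + 1)))‖ₑ⁻¹) * ‖a‖ₑ := by
  rw [← ofReal_norm, ← norm_iterate_starAlgEquiv Φ n, ofReal_norm]
  by_cases h0 : Φ^[n] x = 0
  · simp [h0]
  obtain ⟨h, hh⟩ := exists_character_norm_apply_eq h0
  -- Invertibility of `b i` makes `Φ^m (b i)` a divisor of `Φ^n x`; a character vanishing on it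
  -- would vanish at `Φ^n x`.
  have hbne : ∀ m i, h (Φ^[m] (b i)) ≠ 0 := fun m i hi => by
    have h1 : Φ^[m] (b i * (c i * Φ.symm^[m] (Φ^[n] x))) = Φ^[n] x := by
      rw [← mul_assoc, hc, he, iterate_symm_iterate]
    rw [iterate_map_mul] at h1
    have h2 := congrArg h h1
    rw [map_mul, hi, zero_mul] at h2
    rw [← h2, norm_zero, eq_comm, norm_eq_zero] at hh
    exact h0 hh
  have h1 := enorm_character_genBilateralShift Φ b hb h n (single (j - n) x) j
  rw [hx, single_same, single_same] at h1
  set P := ∏ i ∈ Finset.Icc 1 n, ‖h (Φ^[i - 1] (b (j - i + 1)))‖ₑ with hP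
  have hP0 : P ≠ 0 := Finset.prod_ne_zero_iff.mpr fun i _ => enorm_ne_zero.mpr (hbne _ _)
  have hPt : P ≠ ∞ := ENNReal.prod_ne_top fun i _ => enorm_ne_top
  rw [← ofReal_norm, ← hh, ofReal_norm]
  calc ‖h (Φ^[n] x)‖ₑ = P⁻¹ * ‖h a‖ₑ := by
        rw [h1, ← mul_assoc, ENNReal.inv_mul_cancel hP0 hPt, one_mul]
    _ ≤ _ := by
        refine mul_le_mul' ?_ (enorm_character_apply_le h a)
        rw [hP, ENNReal.prod_inv_distrib fun i _ j _ _ => Or.inr enorm_ne_top]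
        exact le_iSup₂ (f := fun (h : characterSpace ℂ A) (_ : h ∈ Set.univ) =>
          ∏ i ∈ Finset.Icc 1 n, ‖h (Φ^[i - 1] (b (j - i + 1)))‖ₑ⁻¹) h (Set.mem_univ h)

theorem norm_single_le_norm_genBilateralShift_one {e : A} (he : ∀ a, e * a = a) {c : ℤ → A}
    (hc : ∀ j, b j * c j = e) {C : ℝ} (hC : ∀ j, ‖c j‖ ≤ C) (j : ℤ) (x : A) :
    ‖single j x‖ ≤ C * ‖genBilateralShift Φ b hb 1 (single j x)‖ := by
  rw [genBilateralShift_one_single, norm_single, norm_single]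
  have h1 : Φ x = c (j + 1) * (b (j + 1) * Φ x) := by
    rw [← mul_assoc, mul_comm (c _), hc, he]
  have h2 : ‖Φ x‖ = ‖x‖ := norm_iterate_starAlgEquiv Φ 1 x
  calc ‖x‖ = ‖c (j + 1) * (b (j + 1) * Φ x)‖ := by rw [← h1, h2]
    _ ≤ _ := (norm_mul_le _ _).trans (mul_le_mul_of_nonneg_right (hC _) (norm_nonneg _))

theorem isHypercyclicSeq_of_weightCondition [TopologicalSpace.SeparableSpace A]
    {e : A} (he : ∀ a, e * a = a) {c : ℤ → A} (hc : ∀ j, b j * c j = e)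
    (hcb : BddAbove (Set.range fun j => ‖c j‖)) (hw : WeightCondition Φ b) :
    IsHypercyclicSeq (genBilateralShift Φ b hb) := by
  -- The zero algebra has no characters, so the weight condition is void there; the module is then
  -- `{0}`.
  rcases subsingleton_or_nontrivial A with hA | hA
  · exact ⟨0, fun x => by
      rw [show x = 0 from StdHilbertModule.ext fun j => Subsingleton.elim _ _]
      exact subset_closure ⟨0, map_zero _⟩⟩
  obtain ⟨C, hC⟩ := hcb
  replace hC : ∀ j, ‖c j‖ ≤ C := fun j => hC ⟨j, rfl⟩
  obtain ⟨a₀, ha₀⟩ := exists_ne (0 : A)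
  obtain ⟨h₀, -⟩ := exists_character_norm_apply_eq ha₀
  obtain ⟨r, -, -, hr⟩ := hw Set.univ ⟨h₀, Set.mem_univ _⟩ (isCompact_univ_characterSpace he) {1}
    (Finset.singleton_nonempty 1) (by simp)
  obtain ⟨hr₁, hr₂⟩ := hr 1 (Finset.mem_singleton_self 1)
  rw [Nat.cast_one] at hr₁ hr₂
  set T := genBilateralShift Φ b hb
  have hcomm : ∀ n x, T n (T 1 x) = T 1 (T n x) := fun n x => by
    simp only [T, genBilateralShift_comp, add_comm]
  have hstep : ∀ j a, ∃ a', T 1 (single j a') = single (j + 1) a := fun j a =>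
    ⟨_, genBilateralShift_one_single_symm he hc j a⟩
  have hlow : ∀ j x, ‖single j x‖ ≤ C * ‖T 1 (single j x)‖ :=
    norm_single_le_norm_genBilateralShift_one he hc hC
  -- Induction both ways from index `1`: upwards by continuity of `T 1`, downwards by its lower
  -- bound `hlow`, which applies because the images are again one-entry sequences.
  have key₁ : ∀ (j : ℤ) (a : A), Tendsto (fun k => T (r k) (single j a)) atTop (𝓝 0) := by
    intro j
    induction j using Int.inductionOn' (b := 1) with
    | zero =>
      exact fun a => tendsto_zero_of_enorm_le_mul hr₁ enorm_ne_top fun k =>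
        enorm_genBilateralShift_single_le (r k) 1 a
    | succ j _ ih =>
      intro a
      obtain ⟨a', ha'⟩ := hstep j a
      simp_rw [← ha', hcomm]
      simpa [Function.comp_def] using ((T 1).continuous.tendsto 0).comp (ih a')
    | pred j _ ih =>
      intro a
      have h1 := ((ih (b (j - 1 + 1) * Φ a)).norm).const_mul C
      rw [norm_zero, mul_zero] at h1
      refine squeeze_zero_norm (fun k => ?_) h1
      have h2 := hlow (j - 1 + r k) (T (r k) (single (j - 1) a) (j - 1 + r k))
      have h3 := genBilateralShift_one_single (Φ := Φ) (hb := hb) (j - 1) a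
      rw [← genBilateralShift_single, ← hcomm, h3, sub_add_cancel] at h2
      rwa [sub_add_cancel]
  -- The preimages are kept as one-entry sequences at `j - r k`, so that `hlow` is available in the
  -- downward step.
  have key₂ : ∀ (j : ℤ) (a : A), ∃ x : ℕ → A, Tendsto (fun k => single (j - r k) (x k)) atTop (𝓝 0) ∧
      ∀ k, T (r k) (single (j - r k) (x k)) = single j a := by
    intro j
    induction j using Int.inductionOn' (b := 1) with
    | zero =>
      intro a
      choose x hx using fun k => exists_genBilateralShift_single_eq (Φ := Φ) (hb := hb)
        he hc (r k) 1 a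
      refine ⟨x, tendsto_zero_of_enorm_le_mul hr₂ (enorm_ne_top (x := a)) fun k => ?_, hx⟩
      rw [← ofReal_norm, norm_single, ofReal_norm]
      exact enorm_le_of_genBilateralShift_single_eq he hc (hx k)
    | succ j _ ih =>
      intro a
      obtain ⟨a', ha'⟩ := hstep j a
      obtain ⟨x, hx, hx'⟩ := ih a'
      have h1 : ∀ k, single (j + 1 - r k) (b (j - r k + 1) * Φ (x k))
          = T 1 (single (j - r k) (x k)) := fun k => by
        rw [genBilateralShift_one_single, sub_add_eq_add_sub]
      refine ⟨fun k => b (j - r k + 1) * Φ (x k), ?_, fun k => ?_⟩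
      · simp_rw [h1]
        simpa [Function.comp_def] using ((T 1).continuous.tendsto 0).comp hx
      · rw [h1, hcomm, hx', ha']
    | pred j _ ih =>
      intro a
      obtain ⟨x, hx, hx'⟩ := ih (b (j - 1 + 1) * Φ a)
      choose y hy using fun k => hstep (j - 1 - r k) (x k)
      have hy' : ∀ k, T 1 (single (j - 1 - r k) (y k)) = single (j - r k) (x k) := fun k => by
        rw [hy, show j - 1 - (r k : ℤ) + 1 = j - r k by ring]
      -- The required equation is checked after applying the injective `T 1`, where it becomes the
      -- one known at index `j`.
      refine ⟨y, ?_, fun k => genBilateralShift_one_injective (Φ := Φ) (hb := hb) he hc ?_⟩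
      · have h1 := hx.norm.const_mul C
        rw [norm_zero, mul_zero] at h1
        refine squeeze_zero_norm (fun k => ?_) h1
        rw [← hy']
        exact hlow _ _
      · change T 1 _ = T 1 _
        rw [← hcomm, hy', hx', genBilateralShift_one_single, sub_add_cancel]
  have := separableSpace (A := A)
  refine isHypercyclicSeq_of_criterion T r _ dense_span_single ?_ ?_
  · rintro _ ⟨j, a, rfl⟩
    exact key₁ j a
  · rintro _ ⟨j, a, rfl⟩
    obtain ⟨x, hx, hx'⟩ := key₂ j a
    exact ⟨_, hx, hx'⟩

end Main

theorem theorem2p2 {A : Type*} [NonUnitalCommCStarAlgebra A] (Φ : A ≃⋆ₐ[ℂ] A) (b : ℤ → A)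
    (hb : BddAbove (Set.range fun j => ‖b j‖)) :
    (IsHypercyclicSeq (genBilateralShift Φ b hb) → WeightCondition Φ b) ∧
    (∀ (_hsep : TopologicalSpace.SeparableSpace A) (e : A) (_he : ∀ a, e * a = a)
      (c : ℤ → A) (_hc : ∀ j, b j * c j = e) (_hcb : BddAbove (Set.range fun j => ‖c j‖)),
      WeightCondition Φ b → IsHypercyclicSeq (genBilateralShift Φ b hb)) :=
  ⟨weightCondition_of_isHypercyclicSeq, fun _ _ he _ hc hcb =>
    isHypercyclicSeq_of_weightCondition he hc hcb⟩
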